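/- Let $\mathcal Z$ be a $\mathbf Z$-group, that is, a linearly ordered abelian group with a smallest positive element $1$ (so that $\mathbf Z\subseteq\mathcal Z$) such that $\mathcal Z/n\mathcal Z$ has $n$ elements for every integer $n\ge 1$. Let $\mathcal Q$ be its divisible hull, $\Gamma=\mathcal Z\cup\{+\infty\}$ and $\Omega=\mathcal Q\cup\{+\infty\}$. Endow $\Omega$ with the topology generated by the open intervals $]a,b[$ and the intervals $]a,+\infty]$ ($a,b\in\mathcal Q$), and $\Omega^m$ with the product topology; $\overline{A}$ denotes the closure of $A$ in $\Omega^m$. For $a\in\Omega^m$ let $\operatorname{Supp} a=\{i : a_i\ne+\infty\}$. For $J\subseteq\{1,\dots,m\}$ and $A\subseteq\Omega^m$ let $F_J(A)=\{a\in\overline{A} : \operatorname{Supp} a=J\}$, which is called the face of $A$ with support $J$ when it is non-empty, and let $\pi_J$ be the projection that keeps the coordinates with index in $J$ and replaces the other ones by $+\infty$. Thus $F_I(\Gamma^m)$, the set of points of $\Gamma^m$ with support $I$, is identified with $\mathcal Z^I$. A basic Presburger set $A\subseteq F_I(\Gamma^m)$ is the set of solutions in $F_I(\Gamma^m)$ of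 finitely many inequalities $\varphi_l(x)\ge\gamma_l$ and finitely many congruences $\psi_l(x)-\rho_l\in n_l\mathcal Z$, where $\varphi_l,\psi_l$ are of the form $x\mapsto\sum_{i\in I}\alpha_i x_i$ with $\alpha_i\in\mathbf Z$, $\gamma_l\in\mathcal Z$, and $\rho_l,n_l$ are integers with $0\le\rho_l<n_l$. For subsets $B,C$ of $\Omega^m$, one says that $B\le C$ for specialisation if $B\subseteq\overline{C}$. **Proposition 3.2.** Let $A\subseteq F_I(\Gamma^m)$ be a basic Presburger set, and let $J,H\subseteq\{1,\dots,m\}$ be such that $F_J(A)$ and $F_H(A)$ are non-empty. Then: 1. $F_J(A)=\pi_J(A)$. 2. If $H\subseteq J$ then $F_H(A)=F_H(F_J(A))$. 3. $F_H(A)\subseteq\overline{F_J(A)}$ if and only if $H\subseteq J$. In particular, the faces of $A$ are linearly ordered by specialisation if and only if their supports are linearly ordered by inclusion. 4. $F_{H\cap J}(A)$ is non-empty. Hence specialisation is a partial order on the set of faces of $A$ which makes it a lower semilattice, in which $F_{H\cap J}(A)$ is the greatest lower bound of $F_H(A)$ and $F_J(A)$, and which has a smallest element. -/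

import Mathlib

namespace Presburger

/-- A `ℤ`-group: a linearly ordered (abelian) group `Z` with a smallest positive element, denoted
`1`, such that `Z / nZ` has exactly `n` elements for every integer `n ≥ 1`. The element `1` is
determined by the ordered group. -/
class ZGroup (Z : Type*) [AddCommGroup Z] [LinearOrder Z] [IsOrderedAddMonoid Z] [One Z] :
    Prop where
  isLeast_one : IsLeast {z : Z | 0 < z} 1
  card_quotient : ∀ n : ℕ, 1 ≤ n → Nat.card (Z ⧸ (nsmulAddMonoidHom (α := Z) n).range) = n

section

variable (Z : Type*) [AddCommGroup Z] [LinearOrder Z] [IsOrderedAddMonoid Z]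

/-- `Ω = Q ∪ {+∞}`, where `Q` is the divisible hull of `Z`. -/
abbrev Omega : Type _ := WithTop (DivisibleHull Z)

/-- The topology of `Ω`, generated by the open intervals `]a, b[` and the intervals `]a, +∞]`,
for `a` and `b` in the divisible hull. The space `Fin m → Omega Z`, that is `Ω^m`,
then carries the product topology. -/
instance instTopologicalSpaceOmega : TopologicalSpace (Omega Z) :=
  TopologicalSpace.generateFrom
    ({s | ∃ a b : DivisibleHull Z, s = Set.Ioo (a : Omega Z) (b : Omega Z)} ∪
      {s | ∃ a : DivisibleHull Z, s = Set.Ioc (a : Omega Z) ⊤})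

end

section

variable {Z : Type*} [AddCommGroup Z] [LinearOrder Z] [IsOrderedAddMonoid Z] {m : ℕ}

/-- The inclusion of `Z` in `Ω`. -/
def toOmega (z : Z) : Omega Z := ((DivisibleHull.coe z : DivisibleHull Z) : WithTop _)

/-- The support of `a ∈ Ω^m`: the set of the indices `i` such that `a_i ≠ +∞`. -/
def supp (a : Fin m → Omega Z) : Finset (Fin m) := Finset.univ.filter fun i => a i ≠ ⊤

/-- `F_J(A)`: the points of the closure of `A` whose support is `J`. -/
def face (J : Finset (Fin m)) (A : Set (Fin m → Omega Z)) : Set (Fin m → Omega Z) :=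
  {a | a ∈ closure A ∧ supp a = J}

/-- The faces of `A`: the non-empty sets `F_J(A)`. -/
def faces (A : Set (Fin m → Omega Z)) : Set (Set (Fin m → Omega Z)) :=
  {B | B.Nonempty ∧ ∃ J : Finset (Fin m), B = face J A}

/-- The supports of the faces of `A`. -/
def faceSupports (A : Set (Fin m → Omega Z)) : Set (Finset (Fin m)) :=
  {J | (face J A).Nonempty}

/-- The specialisation pre-order on the subsets of `Ω^m`: `B` is contained in the closure
of `C`. -/
def Specializes (B C : Set (Fin m → Omega Z)) : Prop := B ⊆ closure C

/-- The projection `π_J`: it keeps the coordinates of index in `J`, and replaces the other ones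
by `+∞`. -/
def proj (J : Finset (Fin m)) (a : Fin m → Omega Z) : Fin m → Omega Z :=
  fun i => if i ∈ J then a i else ⊤

/-- The identification of `Z^I` with `F_I(Γ^m)`, where `Γ = Z ∪ {+∞}`: the point with coordinates
`z_i` for `i ∈ I` and `+∞` elsewhere. -/
def facePoint (I : Finset (Fin m)) (z : I → Z) : Fin m → Omega Z :=
  fun i => if h : i ∈ I then toOmega (z ⟨i, h⟩) else ⊤

/-- The range of `facePoint I` is the set `F_I(Γ^m)` of the points of `Γ^m` with support `I`. -/
theorem mem_range_facePoint (I : Finset (Fin m)) (a : Fin m → Omega Z) :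
    a ∈ Set.range (facePoint (Z := Z) I) ↔
      (∀ i, a i ∈ insert ⊤ (Set.range (toOmega (Z := Z)))) ∧ supp a = I := by
  constructor
  · rintro ⟨z, rfl⟩
    refine ⟨fun i => ?_, ?_⟩
    · by_cases h : i ∈ I
      · exact Or.inr ⟨z ⟨i, h⟩, by simp [facePoint, h]⟩
      · exact Or.inl (by simp [facePoint, h])
    · ext i
      by_cases h : i ∈ I <;> simp [supp, facePoint, toOmega, h]
  · rintro ⟨ha, rfl⟩
    have key : ∀ i : supp a, ∃ z : Z, toOmega z = a i := by
      rintro ⟨i, hi⟩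
      rcases ha i with h | h
      · simp [supp, h] at hi
      · exact h
    choose z hz using key
    refine ⟨z, funext fun i => ?_⟩
    by_cases h : i ∈ supp a
    · simp only [facePoint, h, dif_pos, hz]
    · have : a i = ⊤ := by simpa [supp] using h
      simp [facePoint, h, this]

/-- The integrally linear map on `Z^I` with coefficients `α_i ∈ ℤ`, for `i ∈ I`. -/
def intLinear {I : Finset (Fin m)} (α : I → ℤ) (z : I → Z) : Z := ∑ i, α i • z i

/-- `a ≡ b [n]`: the difference `a - b` belongs to `nZ`. -/
def Congr (n : ℤ) (a b : Z) : Prop := ∃ c : Z, a - b = n • c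

/-- `A` is a basic Presburger subset of `F_I(Γ^m)`: the set of the points of `F_I(Γ^m)` that satisfy
finitely many linear inequalities `φ_l(x) ≥ γ_l` and finitely many congruence relations
`ψ_l(x) ≡ ρ_l [n_l]`, where `φ_l` and `ψ_l` are integrally linear maps, `γ_l ∈ Z`, and `ρ_l`, `n_l`
are integers such that `0 ≤ ρ_l < n_l`. -/
def IsBasicPresburger [One Z] (I : Finset (Fin m)) (A : Set (Fin m → Omega Z)) : Prop :=
  ∃ (l₀ l₁ : ℕ) (φ : Fin l₀ → I → ℤ) (γ : Fin l₀ → Z)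
    (ψ : Fin l₁ → I → ℤ) (ρ n : Fin l₁ → ℤ),
    (∀ l, 0 ≤ ρ l ∧ ρ l < n l) ∧
    A = {x | ∃ z : I → Z, x = facePoint I z ∧
      (∀ l, γ l ≤ intLinear (φ l) z) ∧
      (∀ l, Congr (n l) (intLinear (ψ l) z) (ρ l • (1 : Z)))}

end

end Presburger

/-! Everything reduces to directions of recession. Suppose that `A` is non-empty. Then `face J A` is
non-empty exactly when `J ⊆ I` and some integer vector `d` vanishes on `J`, is positive on `I \ J`
and satisfies `φ_l(d) ≥ 0` for all `l`. If `d` exists, every `x ∈ A` can be moved along large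
multiples of `d`, divisible by all the moduli, without leaving `A`; the limit is `proj J x`
(`exists_solution`, `proj_mem_closure`). Conversely, `Z` is discrete in its divisible hull, so
points of `A` near a point of the face agree with it on `J` and are arbitrarily large on `I \ J`. If
no direction were positive at `i₀ ∉ J`, a Farkas certificate would bound the coordinate `i₀` above
(`exists_direction_pos_at`). The certificate has integer coefficients, so it applies in `Z` even
when `Z` is not Archimedean. Adding directions intersects supports, and specialisation of faces
becomes inclusion of supports. -/

namespace Presburger

/-! ### Farkas' lemma -/

/-- **Farkas' lemma** over a linearly ordered field: a linear form that is nonnegative wherever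
finitely many given linear forms are nonnegative is a nonnegative combination of them. -/
theorem exists_nonneg_combination {K V : Type*} [Field K] [LinearOrder K] [IsStrictOrderedRing K]
    [AddCommGroup V] [Module K V] :
    ∀ (n : ℕ) (f : Fin n → V →ₗ[K] K) (g : V →ₗ[K] K),
      (∀ x, (∀ i, 0 ≤ f i x) → 0 ≤ g x) →
        ∃ c : Fin n → K, (∀ i, 0 ≤ c i) ∧ g = ∑ i, c i • f i := by
  intro n
  induction n with
  | zero =>
    intro f g h
    refine ⟨fun _ => 0, fun _ => le_rfl, LinearMap.ext fun x => ?_⟩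
    have h₁ := h x fun i => i.elim0
    have h₂ := h (-x) fun i => i.elim0
    simp only [map_neg] at h₂
    simp only [Finset.univ_eq_empty, Finset.sum_empty, LinearMap.zero_apply]
    linarith
  | succ n ih =>
    intro f g h
    by_cases h₀ : ∀ x, (∀ i : Fin n, 0 ≤ f i.castSucc x) → 0 ≤ g x
    · obtain ⟨c, hc, hg⟩ := ih _ g h₀
      refine ⟨Fin.snoc c 0, fun i => ?_, ?_⟩
      · refine Fin.lastCases ?_ (fun j => ?_) i
        · simp
        · simpa using hc j
      · simpa [Fin.sum_univ_castSucc] using hg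
    push Not at h₀
    obtain ⟨v, hv, hgv⟩ := h₀
    have hfv : f (Fin.last n) v < 0 := by
      by_contra hcon
      refine absurd (h v fun i => ?_) (not_le.2 hgv)
      exact Fin.lastCases (not_lt.1 hcon) hv i
    obtain ⟨u, hu, hgu, hfu⟩ : ∃ u, (∀ i : Fin n, 0 ≤ f i.castSucc u) ∧ g u < 0 ∧
        f (Fin.last n) u = -1 := by
      have hpos : 0 < (-f (Fin.last n) v)⁻¹ := inv_pos.2 (neg_pos.2 hfv)
      refine ⟨(-f (Fin.last n) v)⁻¹ • v, fun i => ?_, ?_, ?_⟩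
      · simpa using mul_nonneg hpos.le (hv i)
      · simpa using mul_neg_of_pos_of_neg hpos hgv
      · have := hfv.ne
        simp only [map_smul, smul_eq_mul]
        field_simp
    -- As `f (Fin.last n) u = -1`, the map `x ↦ x + f (Fin.last n) x • u` projects onto the kernel
    -- of the last form. The induction hypothesis is applied to the other forms and `g` composed
    -- with this projection.
    obtain ⟨c, hc, hg⟩ := ih
      (fun i => f i.castSucc + f i.castSucc u • f (Fin.last n)) (g + g u • f (Fin.last n))
      (fun x hx => by
        have := h (x + f (Fin.last n) x • u) fun i => by
          refine Fin.lastCases ?_ (fun j => ?_) i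
          · simp [hfu]
          · have := hx j
            simp only [LinearMap.add_apply, LinearMap.smul_apply, smul_eq_mul] at this
            simp only [map_add, map_smul, smul_eq_mul]
            linarith
        simp only [map_add, map_smul, smul_eq_mul] at this
        simp only [LinearMap.add_apply, LinearMap.smul_apply, smul_eq_mul]
        linarith)
    refine ⟨Fin.snoc c (-g u + ∑ i, c i * f i.castSucc u), fun i => ?_, ?_⟩
    · refine Fin.lastCases ?_ (fun j => ?_) i
      · rw [Fin.snoc_last]
        have := Finset.sum_nonneg fun i (_ : i ∈ Finset.univ) => mul_nonneg (hc i) (hu i)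
        linarith
      · simpa using hc j
    · rw [Fin.sum_univ_castSucc]
      simp only [Fin.snoc_castSucc, Fin.snoc_last]
      refine LinearMap.ext fun x => ?_
      have := LinearMap.congr_fun hg x
      simp only [LinearMap.add_apply, LinearMap.smul_apply, smul_eq_mul, LinearMap.sum_apply,
        mul_add, Finset.sum_add_distrib] at this ⊢
      rw [add_mul, Finset.sum_mul]
      simp only [mul_assoc] at this ⊢
      linarith

/-- Finitely many rational numbers have a common denominator. -/
theorem exists_common_denominator {ι : Type*} [Finite ι] (v : ι → ℚ) :
    ∃ D : ℤ, 0 < D ∧ ∃ w : ι → ℤ, ∀ i, (w i : ℚ) = D * v i := by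
  cases nonempty_fintype ι
  refine ⟨∏ i, ((v i).den : ℤ), Finset.prod_pos fun i _ => by exact_mod_cast (v i).den_pos, ?_⟩
  have : ∀ i, ∃ w : ℤ, (w : ℚ) = ((∏ i, ((v i).den : ℤ) : ℤ) : ℚ) * v i := fun i => by
    obtain ⟨k, hk⟩ := Finset.dvd_prod_of_mem (fun i => ((v i).den : ℤ)) (Finset.mem_univ i)
    refine ⟨k * (v i).num, ?_⟩
    rw [hk]
    push_cast
    rw [mul_comm ((v i).den : ℚ), mul_assoc, Rat.den_mul_eq_num]
  exact Classical.axiomOfChoice this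

/-- Farkas' lemma for systems of homogeneous linear inequalities with integer coefficients. -/
theorem exists_int_solution_or_combination {ι κ : Type*} [Fintype ι] [Fintype κ] (c : ι → κ → ℤ)
    (b : κ → ℤ) :
    (∃ d : κ → ℤ, (∀ i, 0 ≤ ∑ k, c i k * d k) ∧ ∑ k, b k * d k < 0) ∨
      ∃ D : ℤ, 0 < D ∧ ∃ w : ι → ℤ, (∀ i, 0 ≤ w i) ∧ ∀ k, D * b k = ∑ i, w i * c i k := by
  classical
  let form : (κ → ℤ) → (κ → ℚ) →ₗ[ℚ] ℚ := fun a => ∑ k, (a k : ℚ) • LinearMap.proj k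
  have form_apply : ∀ a x, form a x = ∑ k, (a k : ℚ) * x k := fun a x => by
    simp [form, LinearMap.sum_apply]
  have form_int : ∀ (a d : κ → ℤ) (D : ℤ) (x : κ → ℚ), (∀ k, (d k : ℚ) = D * x k) →
      ((∑ k, a k * d k : ℤ) : ℚ) = D * form a x := fun a d D x hd => by
    rw [form_apply, Finset.mul_sum]
    push_cast
    exact Finset.sum_congr rfl fun k _ => by rw [hd]; ring
  let e := Fintype.equivFin ι
  by_cases h : ∀ x, (∀ i, 0 ≤ form (c (e.symm i)) x) → 0 ≤ form b x
  · right
    obtain ⟨v, hv, hb⟩ := exists_nonneg_combination _ _ _ h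
    obtain ⟨D, hD, w, hw⟩ := exists_common_denominator fun i => v (e i)
    have hD' : (0 : ℚ) < D := by exact_mod_cast hD
    refine ⟨D, hD, w, fun i => ?_, fun k => ?_⟩
    · have : (0 : ℚ) ≤ w i := by rw [hw]; exact mul_nonneg hD'.le (hv _)
      exact_mod_cast this
    · have := LinearMap.congr_fun hb (Pi.single k 1)
      simp only [LinearMap.sum_apply, LinearMap.smul_apply, form_apply, Pi.single_apply, mul_ite,
        mul_one, mul_zero, Finset.sum_ite_eq', Finset.mem_univ, if_true, smul_eq_mul] at this
      rw [← e.sum_comp] at this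
      simp only [Equiv.symm_apply_apply] at this
      have key : ((D * b k : ℤ) : ℚ) = ((∑ i, w i * c i k : ℤ) : ℚ) := by
        push_cast
        rw [this, Finset.mul_sum]
        exact Finset.sum_congr rfl fun i _ => by rw [hw]; ring
      exact_mod_cast key
  · left
    push Not at h
    obtain ⟨x, hx, hbx⟩ := h
    obtain ⟨D, hD, d, hd⟩ := exists_common_denominator x
    have hD' : (0 : ℚ) < D := by exact_mod_cast hD
    refine ⟨d, fun i => ?_, ?_⟩
    · have := mul_nonneg hD'.le (hx (e i))
      rw [Equiv.symm_apply_apply, ← form_int _ _ _ _ hd] at this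
      exact_mod_cast this
    · have := mul_neg_of_pos_of_neg hD' hbx
      rw [← form_int _ _ _ _ hd] at this
      exact_mod_cast this

/-! ### The topology of `Ω^m` -/

section

variable {Z : Type*} [AddCommGroup Z] [LinearOrder Z] [IsOrderedAddMonoid Z]

theorem toOmega_lt_toOmega {z w : Z} : toOmega z < toOmega w ↔ z < w := by
  simp [toOmega, DivisibleHull.mk_lt_mk]

theorem toOmega_injective : Function.Injective (toOmega (Z := Z)) := fun z w h => by
  simpa [toOmega] using h

/-- `Z` is cofinal in its divisible hull. -/
theorem exists_le_toOmega (q : DivisibleHull Z) : ∃ z : Z, (q : Omega Z) ≤ toOmega z := by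
  induction q with
  | mk x n =>
    refine ⟨|x|, WithTop.coe_le_coe.2 (DivisibleHull.mk_le_mk.2 ?_)⟩
    rw [PNat.one_coe, one_smul]
    exact (le_abs_self x).trans (le_self_nsmul (abs_nonneg x) n.pos.ne')

theorem isOpen_Ioo (a b : DivisibleHull Z) : IsOpen (Set.Ioo (a : Omega Z) b) :=
  TopologicalSpace.isOpen_generateFrom_of_mem (Or.inl ⟨a, b, rfl⟩)

theorem isOpen_Ioc_top (a : DivisibleHull Z) : IsOpen (Set.Ioc (a : Omega Z) ⊤) :=
  TopologicalSpace.isOpen_generateFrom_of_mem (Or.inr ⟨a, rfl⟩)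

variable {m : ℕ}

theorem mem_supp {a : Fin m → Omega Z} {i : Fin m} : i ∈ supp a ↔ a i ≠ ⊤ := by
  simp [supp]

/-- A criterion for a point to lie in the closure of `B`. -/
theorem mem_closure_of_forall_exists {B : Set (Fin m → Omega Z)} {a : Fin m → Omega Z}
    (h : ∀ γ : Z, 0 ≤ γ → ∃ x ∈ B, ∀ i, x i = a i ∨ (a i = ⊤ ∧ toOmega γ < x i)) :
    a ∈ closure B := by
  -- A net indexed by `Z` itself, since `Z` need not have a countable cofinal subset.
  choose x hxB hx using fun γ : Z => h |γ| (abs_nonneg γ)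
  have lim : Filter.Tendsto x Filter.atTop (nhds a) := by
    refine tendsto_pi_nhds.2 fun i => TopologicalSpace.tendsto_nhds_generateFrom_iff.2 ?_
    rintro s hs ha
    by_cases hi : a i = ⊤
    · rcases hs with ⟨b, c, rfl⟩ | ⟨b, rfl⟩
      · exact absurd (hi ▸ ha.2) not_top_lt
      · obtain ⟨z, hz⟩ := exists_le_toOmega b
        filter_upwards [Filter.eventually_ge_atTop z] with γ hγ
        refine ⟨?_, le_top⟩
        rcases hx γ i with h' | h'
        · simp only [h', hi]
          exact WithTop.coe_lt_top _
        · refine (hz.trans ?_).trans_lt h'.2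
          exact not_lt.1 fun hlt =>
            absurd (toOmega_lt_toOmega.1 hlt) (not_lt.2 (hγ.trans (le_abs_self γ)))
    · refine Filter.Eventually.of_forall fun γ => ?_
      rcases hx γ i with h' | h'
      · exact (show x γ i ∈ s from h' ▸ ha)
      · exact absurd h'.1 hi
  exact mem_closure_of_tendsto lim (Filter.Eventually.of_forall hxB)

variable [One Z] [ZGroup Z]

theorem ZGroup.zero_lt_one : (0 : Z) < 1 := ZGroup.isLeast_one.1

theorem ZGroup.one_le_of_pos {z : Z} (h : 0 < z) : 1 ≤ z := ZGroup.isLeast_one.2 h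

/-- A point of the divisible hull has a neighbourhood that contains no other point of `Γ`. -/
theorem exists_isOpen_separating (q : DivisibleHull Z) :
    ∃ U : Set (Omega Z), IsOpen U ∧ (q : Omega Z) ∈ U ∧ ⊤ ∉ U ∧
      ∀ z : Z, toOmega z ∈ U → toOmega z = q := by
  induction q with
  | mk x n =>
    have h1 := ZGroup.zero_lt_one (Z := Z)
    -- If `z` lies between `(x - 1)/n` and `(x + 1)/n`, then `x - 1 < n z < x + 1`, so `n z = x`
    -- because `1` is the least positive element.
    refine ⟨_, isOpen_Ioo (DivisibleHull.mk (x - 1) n) (DivisibleHull.mk (x + 1) n), ⟨?_, ?_⟩,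
      fun h => not_top_lt h.2, fun z hz => ?_⟩
    · refine WithTop.coe_lt_coe.2 (DivisibleHull.mk_lt_mk.2 ?_)
      exact nsmul_lt_nsmul_right n.pos.ne' (sub_lt_self x h1)
    · refine WithTop.coe_lt_coe.2 (DivisibleHull.mk_lt_mk.2 ?_)
      exact nsmul_lt_nsmul_right n.pos.ne' (lt_add_of_pos_right x h1)
    · have ha := DivisibleHull.mk_lt_mk.1 (WithTop.coe_lt_coe.1 hz.1)
      have hb := DivisibleHull.mk_lt_mk.1 (WithTop.coe_lt_coe.1 hz.2)
      simp only [PNat.one_coe, one_smul] at ha hb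
      have hx : n.val • z = x := by
        refine le_antisymm ?_ ?_
        · by_contra h
          have := ZGroup.one_le_of_pos (sub_pos.2 (not_le.1 h))
          exact absurd (le_sub_iff_add_le'.1 this) (not_le.2 hb)
        · by_contra h
          have := ZGroup.one_le_of_pos (sub_pos.2 (not_le.1 h))
          exact absurd (le_sub_comm.1 this) (not_le.2 ha)
      refine congrArg _ (DivisibleHull.mk_eq_mk_iff_smul_eq_smul.2 ?_)
      rw [PNat.one_coe, one_smul, hx]

/-- A point of the closure of `B` can be approximated by points of `B` that are arbitrarily large
where it is infinite, and that coincide with it at the finite coordinates where they lie in `Γ`. -/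
theorem exists_mem_of_mem_closure {B : Set (Fin m → Omega Z)} {a : Fin m → Omega Z}
    (ha : a ∈ closure B) (γ : Z) :
    ∃ x ∈ B, ∀ i, (a i = ⊤ → toOmega γ < x i) ∧
      (a i ≠ ⊤ → x i ≠ ⊤ ∧ ∀ z : Z, x i = toOmega z → x i = a i) := by
  have key : ∀ i, ∃ U : Set (Omega Z), IsOpen U ∧ a i ∈ U ∧ ∀ y ∈ U, (a i = ⊤ → toOmega γ < y) ∧
      (a i ≠ ⊤ → y ≠ ⊤ ∧ ∀ z : Z, y = toOmega z → y = a i) := fun i => by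
    by_cases h : a i = ⊤
    · exact ⟨_, isOpen_Ioc_top (DivisibleHull.coe γ),
        by rw [h]; exact ⟨WithTop.coe_lt_top _, le_rfl⟩, fun y hy => ⟨fun _ => hy.1, fun h' => absurd h h'⟩⟩
    · obtain ⟨q, hq⟩ := WithTop.ne_top_iff_exists.1 h
      obtain ⟨U, hU, hqU, htop, hz⟩ := exists_isOpen_separating q
      refine ⟨U, hU, hq ▸ hqU, fun y hy => ⟨fun h' => absurd h' h, fun _ => ⟨?_, ?_⟩⟩⟩
      · rintro rfl
        exact htop hy
      · rintro z rfl
        exact (hz z hy).trans hq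
  choose U hU haU hprop using key
  obtain ⟨x, hxU, hxB⟩ := mem_closure_iff.1 ha (Set.univ.pi U)
    (isOpen_set_pi Set.finite_univ fun i _ => hU i) fun i _ => haU i
  exact ⟨x, hxB, fun i => hprop i _ (hxU i trivial)⟩

end

/-! ### Directions of recession of a basic Presburger set -/

section

variable {Z : Type*} [AddCommGroup Z] {m : ℕ}

theorem facePoint_of_mem {I : Finset (Fin m)} {z : I → Z} {i : Fin m} (h : i ∈ I) :
    facePoint I z i = toOmega (z ⟨i, h⟩) := dif_pos h

theorem facePoint_of_notMem {I : Finset (Fin m)} {z : I → Z} {i : Fin m} (h : i ∉ I) :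
    facePoint I z i = ⊤ := dif_neg h

theorem intLinear_add_smul {I : Finset (Fin m)} (α d : I → ℤ) (k : ℤ) (z : I → Z) (g : Z) :
    intLinear α (fun i => z i + (k * d i) • g) =
      intLinear α z + (k * ∑ i, α i * d i) • g := by
  simp only [intLinear, smul_add, Finset.sum_add_distrib, Finset.mul_sum, Finset.sum_smul,
    smul_smul]
  congr 1
  exact Finset.sum_congr rfl fun i _ => by congr 1; ring

variable [LinearOrder Z] [IsOrderedAddMonoid Z]

/-- `J ⊆ I`, and some integer direction that vanishes exactly on `J` and is positive elsewhere
does not decrease any of the linear maps `φ_l`. -/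
def IsRecessionSupport {I : Finset (Fin m)} {l : ℕ} (φ : Fin l → I → ℤ) (J : Finset (Fin m)) :
    Prop :=
  J ⊆ I ∧ ∃ d : I → ℤ, (∀ i, i.1 ∈ J → d i = 0) ∧ (∀ i, i.1 ∉ J → 0 < d i) ∧
    ∀ l, 0 ≤ ∑ i, φ l i * d i

/-- Both directions are nonnegative, so their sum vanishes exactly where both do. -/
theorem IsRecessionSupport.inter {I : Finset (Fin m)} {l : ℕ} {φ : Fin l → I → ℤ}
    {J H : Finset (Fin m)} (hH : IsRecessionSupport φ H) (hJ : IsRecessionSupport φ J) :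
    IsRecessionSupport φ (H ∩ J) := by
  obtain ⟨hI, d, hd₀, hd, hφd⟩ := hH
  obtain ⟨-, e, he₀, he, hφe⟩ := hJ
  have nonneg : ∀ (K : Finset (Fin m)) (f : I → ℤ), (∀ i, i.1 ∈ K → f i = 0) →
      (∀ i, i.1 ∉ K → 0 < f i) → ∀ i, 0 ≤ f i := fun K f h₀ h i => by
    by_cases hi : i.1 ∈ K
    · exact (h₀ i hi).ge
    · exact (h i hi).le
  refine ⟨Finset.inter_subset_left.trans hI, d + e, fun i hi => ?_, fun i hi => ?_, fun l => ?_⟩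
  · rw [Finset.mem_inter] at hi
    simp [hd₀ i hi.1, he₀ i hi.2]
  · by_cases h : i.1 ∈ H
    · exact add_pos_of_nonneg_of_pos (nonneg H d hd₀ hd i)
        (he i fun h' => hi (Finset.mem_inter.2 ⟨h, h'⟩))
    · exact add_pos_of_pos_of_nonneg (hd i h) (nonneg J e he₀ he i)
  · simpa [mul_add, Finset.sum_add_distrib] using add_nonneg (hφd l) (hφe l)

/-- Moving along a direction of recession. -/
theorem IsRecessionSupport.exists_solution {I : Finset (Fin m)} {l₀ l₁ : ℕ} {φ : Fin l₀ → I → ℤ}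
    {γ : Fin l₀ → Z} {ψ : Fin l₁ → I → ℤ} {ρ : Fin l₁ → Z} {n : Fin l₁ → ℤ} (hn : ∀ l, 0 < n l)
    {J : Finset (Fin m)} (hJ : IsRecessionSupport φ J) {z : I → Z}
    (hφ : ∀ l, γ l ≤ intLinear (φ l) z) (hψ : ∀ l, Congr (n l) (intLinear (ψ l) z) (ρ l))
    {ε : Z} (hε : 0 < ε) (g : Z) :
    ∃ y : I → Z, (∀ l, γ l ≤ intLinear (φ l) y) ∧ (∀ l, Congr (n l) (intLinear (ψ l) y) (ρ l)) ∧
      (∀ i, i.1 ∈ J → y i = z i) ∧ ∀ i, i.1 ∉ J → g < y i := by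
  obtain ⟨-, d, hd₀, hd, hφd⟩ := hJ
  -- The factor `N` preserves every congruence; `t` is large enough that `z i + t > g` for all `i`
  -- at once.
  set N : ℤ := ∏ l, n l
  have hN : 0 < N := Finset.prod_pos fun l _ => hn l
  set t : Z := |g| + ∑ i, |z i| + ε
  have hsum : 0 ≤ ∑ i, |z i| := Finset.sum_nonneg fun i _ => abs_nonneg (z i)
  have ht : 0 ≤ t := add_nonneg (add_nonneg (abs_nonneg g) hsum) hε.le
  refine ⟨fun i => z i + (N * d i) • t, fun l => ?_, fun l => ?_, fun i hi => ?_, fun i hi => ?_⟩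
  · rw [intLinear_add_smul]
    exact (hφ l).trans (le_add_of_nonneg_right (zsmul_nonneg ht (mul_nonneg hN.le (hφd l))))
  · rw [intLinear_add_smul]
    obtain ⟨c, hc⟩ := hψ l
    obtain ⟨k, hk⟩ : n l ∣ N := Finset.dvd_prod_of_mem n (Finset.mem_univ l)
    refine ⟨c + (k * ∑ i, ψ l i * d i) • t, ?_⟩
    rw [smul_add (n l), ← hc, smul_smul, ← mul_assoc, ← hk, add_sub_right_comm]
  · simp [hd₀ i hi]
  · have h₁ : t ≤ (N * d i) • t := by
      have : (1 : ℤ) ≤ N * d i := Int.add_one_le_iff.2 (by simpa using mul_pos hN (hd i hi))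
      simpa using zsmul_le_zsmul_left ht this
    have h₂ : |z i| ≤ ∑ i, |z i| :=
      Finset.single_le_sum (f := fun i => |z i|) (fun i _ => abs_nonneg _) (Finset.mem_univ i)
    calc g < g + ε := lt_add_of_pos_right g hε
      _ ≤ |g| + (z i + |z i|) + ε := by
          gcongr
          exact le_add_of_le_of_nonneg (le_abs_self g) (neg_le_iff_add_nonneg'.1 (neg_le_abs (z i)))
      _ ≤ |g| + (z i + ∑ i, |z i|) + ε := by gcongr
      _ = z i + t := by simp only [t]; abel
      _ ≤ z i + (N * d i) • t := by gcongr

/-- If solutions of `φ_l ≥ γ_l` with prescribed coordinates in `J` can be arbitrarily large at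
the other coordinates, then some direction of recession vanishes on `J`, is nonnegative, and is
positive at a given index `i₀ ∉ J`. -/
theorem exists_direction_pos_at {I J : Finset (Fin m)} {l : ℕ} {φ : Fin l → I → ℤ}
    {γ : Fin l → Z} {b : I → Z}
    (h : ∀ g : Z, ∃ z : I → Z, (∀ l, γ l ≤ intLinear (φ l) z) ∧ (∀ i, i.1 ∈ J → z i = b i) ∧
      ∀ i, i.1 ∉ J → g < z i)
    {i₀ : I} (hi₀ : i₀.1 ∉ J) :
    ∃ d : I → ℤ, (∀ i, i.1 ∈ J → d i = 0) ∧ (∀ i, 0 ≤ d i) ∧ 0 < d i₀ ∧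
      ∀ l, 0 ≤ ∑ i, φ l i * d i := by
  classical
  -- The rows encode `φ_l(d) ≥ 0`, `d i ≥ 0`, and `-d i ≥ 0` for `i ∈ J` (zero rows pad the other
  -- indices). The target form `-d i₀` is negative precisely when `d i₀ > 0`.
  rcases exists_int_solution_or_combination
    (Sum.elim φ (Sum.elim (fun i => Pi.single i 1) fun i => if i.1 ∈ J then Pi.single i (-1) else 0))
    (Pi.single i₀ (-1)) with ⟨d, hd, hlt⟩ | ⟨D, hD, w, hw, hcomb⟩
  · have hnonneg : ∀ i, 0 ≤ d i := fun i => by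
      simpa [Pi.single_apply] using hd (Sum.inr (Sum.inl i))
    refine ⟨d, fun i hi => le_antisymm ?_ (hnonneg i), hnonneg, ?_, fun l => hd (Sum.inl l)⟩
    · simpa [Pi.single_apply, hi] using hd (Sum.inr (Sum.inr i))
    · simpa [Pi.single_apply] using hlt
  · exfalso
    set c : Fin l ⊕ (I ⊕ I) → I → ℤ := Sum.elim φ (Sum.elim (fun i => Pi.single i 1)
      fun i => if i.1 ∈ J then Pi.single i (-1) else 0)
    -- `t` bounds the rows below at `z`, so the certificate gives `∑ w t ≤ -D z i₀`. In the size
    -- demanded of `z`, the first term contradicts this bound and the second ensures `b i ≤ z i` off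
    -- `J`.
    let t : Fin l ⊕ (I ⊕ I) → Z := Sum.elim γ (Sum.elim b fun i => if i.1 ∈ J then -b i else 0)
    obtain ⟨z, hφ, hzJ, hz⟩ := h (|∑ k, w k • t k| + ∑ i, |b i|)
    have hb : 0 ≤ ∑ i, |b i| := Finset.sum_nonneg fun i _ => abs_nonneg (b i)
    have hct : ∀ k, t k ≤ intLinear (c k) z := by
      rintro (l | i | i)
      · exact hφ l
      · suffices b i ≤ z i by simpa [c, t, intLinear, Pi.single_apply, ite_smul] using this
        by_cases hi : i.1 ∈ J
        · exact (hzJ i hi).ge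
        · refine le_trans ?_ (hz i hi).le
          refine le_add_of_nonneg_of_le (abs_nonneg _) ((le_abs_self _).trans ?_)
          exact Finset.single_le_sum (f := fun i => |b i|) (fun i _ => abs_nonneg _)
            (Finset.mem_univ i)
      · by_cases hi : i.1 ∈ J
        · simp [c, t, intLinear, Pi.single_apply, ite_smul, hi, hzJ i hi]
        · simp [c, t, intLinear, hi]
    have hsum : ∑ k, w k • intLinear (c k) z = -(D • z i₀) := by
      calc ∑ k, w k • intLinear (c k) z = ∑ i, (∑ k, w k * c k i) • z i := by
            simp only [intLinear, Finset.smul_sum, Finset.sum_smul, smul_smul]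
            exact Finset.sum_comm
        _ = -(D • z i₀) := by
            simp only [← hcomb]
            simp [Pi.single_apply, ite_smul]
    have hle : ∑ k, w k • t k ≤ -(D • z i₀) :=
      hsum ▸ Finset.sum_le_sum fun k _ => zsmul_le_zsmul_right (hw k) (hct k)
    have hlt : |∑ k, w k • t k| < z i₀ := (le_add_of_nonneg_right hb).trans_lt (hz i₀ hi₀)
    have hD' : z i₀ ≤ D • z i₀ := by
      have : (1 : ℤ) ≤ D := hD
      simpa using zsmul_le_zsmul_left ((abs_nonneg _).trans hlt.le) this
    exact absurd ((hD'.trans (le_neg.1 hle)).trans (neg_le_abs _)) (not_le.2 hlt)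

/-- Summing the directions obtained for each `i₀ ∉ J` gives one that is positive at all these
indices. -/
theorem isRecessionSupport_of_forall_exists {I J : Finset (Fin m)} (hJ : J ⊆ I) {l : ℕ}
    {φ : Fin l → I → ℤ} {γ : Fin l → Z} {b : I → Z}
    (h : ∀ g : Z, ∃ z : I → Z, (∀ l, γ l ≤ intLinear (φ l) z) ∧ (∀ i, i.1 ∈ J → z i = b i) ∧
      ∀ i, i.1 ∉ J → g < z i) :
    IsRecessionSupport φ J := by
  have key : ∀ i₀ : I, ∃ d : I → ℤ, (∀ i, i.1 ∈ J → d i = 0) ∧ (∀ i, 0 ≤ d i) ∧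
      (i₀.1 ∉ J → 0 < d i₀) ∧ ∀ l, 0 ≤ ∑ i, φ l i * d i := fun i₀ => by
    by_cases hi₀ : i₀.1 ∈ J
    · exact ⟨0, by simp [hi₀]⟩
    · obtain ⟨d, h₀, h₁, h₂, h₃⟩ := exists_direction_pos_at h hi₀
      exact ⟨d, h₀, h₁, fun _ => h₂, h₃⟩
  choose d h₀ h₁ h₂ h₃ using key
  refine ⟨hJ, fun i => ∑ i₀, d i₀ i, fun i hi => Finset.sum_eq_zero fun i₀ _ => h₀ i₀ i hi,
    fun i hi => ?_, fun l => ?_⟩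
  · exact Finset.sum_pos' (fun i₀ _ => h₁ i₀ i) ⟨i, Finset.mem_univ i, h₂ i hi⟩
  · simp only [Finset.mul_sum]
    rw [Finset.sum_comm]
    exact Finset.sum_nonneg fun i₀ _ => h₃ i₀ l

/-! ### Faces of a basic Presburger set -/

variable [One Z] [ZGroup Z]

/-- Finite values are isolated from the rest of `Γ`, so approximation by points of `A` becomes
equality on `J`. -/
theorem exists_facePoint_of_mem_face {I J : Finset (Fin m)} {A : Set (Fin m → Omega Z)}
    (hA : A ⊆ Set.range (facePoint I)) {a : Fin m → Omega Z} (ha : a ∈ face J A) (g : Z) :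
    J ⊆ I ∧ ∃ z : I → Z, facePoint I z ∈ A ∧ (∀ i, i.1 ∈ J → toOmega (z i) = a i) ∧
      ∀ i, i.1 ∉ J → g < z i := by
  obtain ⟨hcl, rfl⟩ := ha
  obtain ⟨x, hxA, hx⟩ := exists_mem_of_mem_closure hcl g
  obtain ⟨z, rfl⟩ := hA hxA
  refine ⟨fun i hi => ?_, z, hxA, fun i hi => ?_, fun i hi => ?_⟩
  · by_contra h
    exact ((hx i).2 (mem_supp.1 hi)).1 (facePoint_of_notMem h)
  · rw [← ((hx i).2 (mem_supp.1 hi)).2 (z i) (facePoint_of_mem i.2), facePoint_of_mem i.2]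
  · have := (hx i).1 (not_not.1 fun h => hi (mem_supp.2 h))
    rwa [facePoint_of_mem i.2, toOmega_lt_toOmega] at this

/-- The recession data of a basic Presburger set: a set of supports, closed under intersection,
that contains the supports of the faces, and along which one can move in the set. -/
theorem IsBasicPresburger.exists_recession {I : Finset (Fin m)} {A : Set (Fin m → Omega Z)}
    (hA : IsBasicPresburger I A) :
    A ⊆ Set.range (facePoint I) ∧ ∃ R : Finset (Fin m) → Prop,
      (∀ J H, R J → R H → R (J ∩ H)) ∧
      (∀ J, R J → J ⊆ I) ∧
      (∀ J, (face J A).Nonempty → R J) ∧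
      ∀ J, R J → ∀ x ∈ A, ∀ g : Z, ∃ y ∈ A, ∀ i,
        (i ∈ J → y i = x i) ∧ (i ∉ J → i ∈ I → toOmega g < y i) := by
  obtain ⟨l₀, l₁, φ, γ, ψ, ρ, n, hn, rfl⟩ := hA
  have hrange : {x | ∃ z : I → Z, x = facePoint I z ∧ (∀ l, γ l ≤ intLinear (φ l) z) ∧
      ∀ l, Congr (n l) (intLinear (ψ l) z) (ρ l • (1 : Z))} ⊆ Set.range (facePoint I) := by
    rintro _ ⟨z, rfl, -⟩
    exact ⟨z, rfl⟩
  refine ⟨hrange, IsRecessionSupport φ, fun J H hJ hH => hJ.inter hH, fun J hJ => hJ.1, ?_, ?_⟩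
  · rintro J ⟨a, ha⟩
    -- `b` serves to name the coordinates of `a` on `J` as elements of `Z`.
    obtain ⟨hJI, b, -, hb, -⟩ := exists_facePoint_of_mem_face hrange ha 0
    refine isRecessionSupport_of_forall_exists (γ := γ) (b := b) hJI fun g => ?_
    obtain ⟨-, z, ⟨z', hz', hφ, -⟩, hzJ, hz⟩ := exists_facePoint_of_mem_face hrange ha g
    obtain rfl : z = z' := funext fun i => toOmega_injective <| by
      rw [← facePoint_of_mem (z := z) i.2, hz', facePoint_of_mem i.2]
    exact ⟨z, hφ, fun i hi => toOmega_injective ((hzJ i hi).trans (hb i hi).symm), hz⟩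
  · rintro J hJ _ ⟨z, rfl, hφ, hψ⟩ g
    obtain ⟨y, hyφ, hyψ, hyJ, hy⟩ := hJ.exists_solution (fun l => (hn l).1.trans_lt (hn l).2) hφ hψ
      ZGroup.zero_lt_one g
    refine ⟨_, ⟨y, rfl, hyφ, hyψ⟩, fun i => ⟨fun hi => ?_, fun hi hI => ?_⟩⟩
    · rw [facePoint_of_mem (hJ.1 hi), facePoint_of_mem (hJ.1 hi), hyJ ⟨i, _⟩ hi]
    · rw [facePoint_of_mem hI, toOmega_lt_toOmega]
      exact hy ⟨i, hI⟩ hi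

end

section

variable {Z : Type*} [AddCommGroup Z] [LinearOrder Z] [IsOrderedAddMonoid Z] {m : ℕ}

theorem supp_proj {I J : Finset (Fin m)} (h : J ⊆ I) (z : I → Z) :
    supp (proj J (facePoint I z)) = J := by
  ext i
  by_cases hi : i ∈ J
  · simp [mem_supp, proj, hi, facePoint_of_mem (h hi), toOmega]
  · simp [mem_supp, proj, hi]

/-- If one can move in `A` from each point towards infinity along the complement of `J`,
then the projections of the points of `A` are adherent to `A`. -/
theorem proj_mem_closure {I J : Finset (Fin m)} {A : Set (Fin m → Omega Z)}
    (hA : A ⊆ Set.range (facePoint I))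
    (h : ∀ x ∈ A, ∀ g : Z, ∃ y ∈ A, ∀ i,
      (i ∈ J → y i = x i) ∧ (i ∉ J → i ∈ I → toOmega g < y i))
    {x : Fin m → Omega Z} (hx : x ∈ A) : proj J x ∈ closure A := by
  refine mem_closure_of_forall_exists fun g _ => ?_
  obtain ⟨y, hyA, hy⟩ := h x hx g
  refine ⟨y, hyA, fun i => ?_⟩
  by_cases hi : i ∈ J
  · exact Or.inl (by rw [(hy i).1 hi, proj, if_pos hi])
  · have htop : proj J x i = ⊤ := if_neg hi
    by_cases hI : i ∈ I
    · exact Or.inr ⟨htop, (hy i).2 hi hI⟩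
    · obtain ⟨z, rfl⟩ := hA hyA
      exact Or.inl (by rw [facePoint_of_notMem hI, htop])

variable [One Z] [ZGroup Z]

/-- This inclusion needs only discreteness: a point of `A` close enough to `a` agrees with it on
`J`. -/
theorem face_subset_image_proj {I J : Finset (Fin m)} {A : Set (Fin m → Omega Z)}
    (hA : A ⊆ Set.range (facePoint I)) : face J A ⊆ proj J '' A := by
  intro a ha
  obtain ⟨hJI, z, hz, hzJ, -⟩ := exists_facePoint_of_mem_face hA ha 0
  refine ⟨_, hz, funext fun i => ?_⟩
  by_cases hi : i ∈ J
  · rw [proj, if_pos hi, facePoint_of_mem (hJI hi), hzJ ⟨i, _⟩ hi]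
  · rw [proj, if_neg hi]
    exact (not_not.1 fun h => hi (ha.2 ▸ mem_supp.2 h)).symm

namespace IsBasicPresburger

variable {I J H : Finset (Fin m)} {A : Set (Fin m → Omega Z)}

/-- A non-empty face is the projection of the whole set. -/
theorem face_eq_image_proj (hA : IsBasicPresburger I A) (hJ : (face J A).Nonempty) :
    face J A = proj J '' A := by
  obtain ⟨hrange, R, -, hRI, hR, hmove⟩ := hA.exists_recession
  refine (face_subset_image_proj hrange).antisymm ?_
  rintro _ ⟨x, hx, rfl⟩
  refine ⟨proj_mem_closure hrange (hmove J (hR J hJ)) hx, ?_⟩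
  obtain ⟨z, rfl⟩ := hrange hx
  exact supp_proj (hRI J (hR J hJ)) z

/-- The supports of the faces are closed under intersection. -/
theorem face_inter_nonempty (hA : IsBasicPresburger I A) (hH : (face H A).Nonempty)
    (hJ : (face J A).Nonempty) : (face (H ∩ J) A).Nonempty := by
  obtain ⟨hrange, R, hinter, hRI, hR, hmove⟩ := hA.exists_recession
  have hHJ := hinter H J (hR H hH) (hR J hJ)
  obtain ⟨x, hx⟩ := closure_nonempty_iff.1 (hJ.mono fun _ h => h.1)
  refine ⟨_, proj_mem_closure hrange (hmove _ hHJ) hx, ?_⟩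
  obtain ⟨z, rfl⟩ := hrange hx
  exact supp_proj (hRI _ hHJ) z

/-- The faces of a face. -/
theorem face_eq_face_face (hA : IsBasicPresburger I A) (hH : (face H A).Nonempty)
    (hJ : (face J A).Nonempty) (hHJ : H ⊆ J) : face H A = face H (face J A) := by
  refine Set.Subset.antisymm (fun a ha => ⟨?_, ha.2⟩) fun a ha =>
    ⟨closure_minimal (fun _ h => h.1) isClosed_closure ha.1, ha.2⟩
  obtain ⟨hrange, R, -, -, hR, hmove⟩ := hA.exists_recession
  -- Write the point as `proj H x`, move `x` in `A` to infinity off `H`, and project by `proj J`: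
  -- the images lie in the face `J` and tend to `proj H x`.
  obtain ⟨x, hx, rfl⟩ := face_subset_image_proj hrange ha
  rw [hA.face_eq_image_proj hJ]
  refine mem_closure_of_forall_exists fun g _ => ?_
  obtain ⟨y, hyA, hy⟩ := hmove H (hR H hH) x hx g
  refine ⟨_, ⟨y, hyA, rfl⟩, fun i => ?_⟩
  by_cases hi : i ∈ H
  · exact Or.inl (by rw [proj, proj, if_pos hi, if_pos (hHJ hi), (hy i).1 hi])
  · have htop : proj H x i = ⊤ := if_neg hi
    by_cases hiJ : i ∈ J
    · by_cases hI : i ∈ I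
      · refine Or.inr ⟨htop, ?_⟩
        rw [proj, if_pos hiJ]
        exact (hy i).2 hi hI
      · obtain ⟨z, rfl⟩ := hrange hyA
        exact Or.inl (by rw [proj, if_pos hiJ, facePoint_of_notMem hI, htop])
    · exact Or.inl (by rw [proj, if_neg hiJ, htop])

/-- Specialisation of faces amounts to the inclusion of their supports. -/
theorem specializes_face_iff (hA : IsBasicPresburger I A) (hH : (face H A).Nonempty)
    (hJ : (face J A).Nonempty) : Specializes (face H A) (face J A) ↔ H ⊆ J := by
  constructor
  · intro h i hi
    obtain ⟨a, ha⟩ := hH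
    -- Points close to `a` are finite wherever `a` is, so supports can only shrink in the limit.
    obtain ⟨x, hx, hxa⟩ := exists_mem_of_mem_closure (h ha) 0
    rw [← ha.2, mem_supp] at hi
    rw [← hx.2, mem_supp]
    exact ((hxa i).2 hi).1
  · intro h
    rw [hA.face_eq_face_face hH hJ h]
    exact fun _ h => h.1

theorem isPartialOrder_specializes (hA : IsBasicPresburger I A) :
    IsPartialOrder (faces A) fun B C => Specializes B.1 C.1 where
  refl B := subset_closure
  trans B C D h h' := h.trans (closure_minimal h' isClosed_closure)
  antisymm := by
    rintro ⟨_, hB, H, rfl⟩ ⟨_, hC, J, rfl⟩ h h'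
    obtain rfl : H = J :=
      ((hA.specializes_face_iff hB hC).1 h).antisymm ((hA.specializes_face_iff hC hB).1 h')
    rfl

theorem isLinearOrder_specializes_iff (hA : IsBasicPresburger I A) :
    IsLinearOrder (faces A) (fun B C => Specializes B.1 C.1) ↔
      IsLinearOrder (faceSupports A) (fun K L => K.1 ⊆ L.1) := by
  constructor
  · intro h
    exact
      { refl := fun K => Finset.Subset.refl _
        trans := fun _ _ _ h h' => Finset.Subset.trans h h'
        antisymm := fun _ _ h h' => Subtype.ext (h.antisymm h')
        total := fun ⟨K, hK⟩ ⟨L, hL⟩ =>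
          (h.total ⟨_, hK, K, rfl⟩ ⟨_, hL, L, rfl⟩).imp (hA.specializes_face_iff hK hL).1
            (hA.specializes_face_iff hL hK).1 }
  · intro h
    refine { hA.isPartialOrder_specializes with total := ?_ }
    rintro ⟨_, hB, K, rfl⟩ ⟨_, hC, L, rfl⟩
    exact (h.total ⟨K, hB⟩ ⟨L, hC⟩).imp (hA.specializes_face_iff hB hC).2
      (hA.specializes_face_iff hC hB).2

/-- If there is a face, there is a smallest one. -/
theorem exists_least_face (hA : IsBasicPresburger I A) (hJ : (face J A).Nonempty) :
    ∃ B₀ ∈ faces A, ∀ B ∈ faces A, Specializes B₀ B := by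
  obtain ⟨K, hK⟩ := (Set.toFinite (faceSupports A)).exists_minimal ⟨J, hJ⟩
  refine ⟨_, ⟨hK.1, K, rfl⟩, ?_⟩
  rintro _ ⟨hB, L, rfl⟩
  refine (hA.specializes_face_iff hK.1 hB).2 ?_
  -- `K ∩ L` is again the support of a face, so minimality of `K` gives `K ⊆ K ∩ L`.
  exact (hK.2 (hA.face_inter_nonempty hK.1 hB) Finset.inter_subset_left).trans
    Finset.inter_subset_right

end IsBasicPresburger

end

end Presburger

theorem proposition3p2 {Z : Type*} [AddCommGroup Z] [LinearOrder Z] [IsOrderedAddMonoid Z]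
    [One Z] [Presburger.ZGroup Z] {m : ℕ} (I : Finset (Fin m)) (A : Set (Fin m → Presburger.Omega Z))
    (hA : Presburger.IsBasicPresburger I A) (J H : Finset (Fin m))
    (hJ : (Presburger.face J A).Nonempty) (hH : (Presburger.face H A).Nonempty) :
    -- (1)
    Presburger.face J A = Presburger.proj J '' A ∧
    -- (2)
    (H ⊆ J → Presburger.face H A = Presburger.face H (Presburger.face J A)) ∧
    -- (3)
    (Presburger.face H A ⊆ closure (Presburger.face J A) ↔ H ⊆ J) ∧
    (IsLinearOrder (Presburger.faces A) (fun B C => Presburger.Specializes B.1 C.1) ↔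
      IsLinearOrder (Presburger.faceSupports A) (fun K L => K.1 ⊆ L.1)) ∧
    -- (4)
    (Presburger.face (H ∩ J) A).Nonempty ∧
    -- the faces form a lower semilattice with a smallest element under specialisation
    IsPartialOrder (Presburger.faces A) (fun B C => Presburger.Specializes B.1 C.1) ∧
    (∀ B ∈ Presburger.faces A,
      Presburger.Specializes B (Presburger.face (H ∩ J) A) ↔
        Presburger.Specializes B (Presburger.face H A) ∧
        Presburger.Specializes B (Presburger.face J A)) ∧
    (∃ B₀ ∈ Presburger.faces A, ∀ B ∈ Presburger.faces A, Presburger.Specializes B₀ B) := by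
  have hHJ := hA.face_inter_nonempty hH hJ
  refine ⟨hA.face_eq_image_proj hJ, hA.face_eq_face_face hH hJ, hA.specializes_face_iff hH hJ,
    hA.isLinearOrder_specializes_iff, hHJ, hA.isPartialOrder_specializes, ?_,
    hA.exists_least_face hJ⟩
  rintro _ ⟨hB, K, rfl⟩
  rw [hA.specializes_face_iff hB hHJ, hA.specializes_face_iff hB hH, hA.specializes_face_iff hB hJ]
  exact Finset.subset_inter_iff
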